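/- An $(n,k,r)$-LRC is a linear code of length $n$ and dimension $k$ over some finite field (of any order) in which the value of each coordinate is a fixed linear combination of the values of at most $r$ other coordinates. Let $n>k\ge r\ge 1$ be integers, and let $\mathscr{D}(n,k,r)$ denote the largest minimum (Hamming) distance of an $(n,k,r)$-LRC; "$\mathscr{D}(n,k,r)=d$" means that such a code of minimum distance $d$ exists and none has larger minimum distance. Put $$d^*=n-k-\left\lceil \tfrac kr\right\rceil+2,\quad k_1=\left\lceil \tfrac kr\right\rceil,\quad k_2=k_1r-k,\quad n_1=\left\lceil \tfrac n{r+1}\right\rceil,\quad n_2=n_1(r+1)-n .$$ Suppose $k_1=2$. Then $$\mathscr{D}(n,k,r)=d^*\quad\Longleftrightarrow\quad n_2\le\binom{n_1}{2}\,k_2 .$$ Moreover, the multigraph on $n_1$ vertices with exactly $k_2$ parallel edges between every two distinct vertices has $\binom{n_1}{2}k_2$ edges, has no subgraph of order $k_1$ and size greater than $k_2$, and has the maximum number of edges among all loopless multigraphs of order $n_1$ with no subgraph of order $k_1$ and size greater than $k_2$. -/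

import Mathlib

open scoped Graph

namespace LRC

/-! ### Linear codes -/

/-- The minimum distance of a linear code `C ⊆ Fⁿ`: the minimum Hamming distance between two
distinct codewords (the infimum is attained as soon as `C` has two distinct codewords). -/
noncomputable def minDist {F : Type*} [Field F] [DecidableEq F] {n : ℕ}
    (C : Submodule F (Fin n → F)) : ℕ :=
  sInf {d | ∃ x ∈ C, ∃ y ∈ C, x ≠ y ∧ hammingDist x y = d}

/-- `C` has (all-symbol) locality `r`: the value of every coordinate of a codeword is a fixed
linear combination of the values of at most `r` other coordinates. -/
def HasLocality {F : Type*} [Field F] {n : ℕ} (C : Submodule F (Fin n → F)) (r : ℕ) : Prop :=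
  ∀ i : Fin n, ∃ S : Finset (Fin n), i ∉ S ∧ S.card ≤ r ∧
    ∃ a : Fin n → F, ∀ c ∈ C, c i = ∑ j ∈ S, a j * c j

/-- `C` is an `(n, k, r)`-locally recoverable code: a linear code of length `n` and dimension `k`
with locality `r`. -/
def IsLRC {F : Type*} [Field F] {n : ℕ} (C : Submodule F (Fin n → F)) (k r : ℕ) : Prop :=
  Module.finrank F C = k ∧ HasLocality C r

open Classical in
/-- The set of all minimum distances of `(n, k, r)`-LRCs, over finite fields of any order. -/
def minDistSet (n k r : ℕ) : Set ℤ :=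
  {d | ∃ (F : Type) (_ : Field F) (_ : Finite F) (C : Submodule F (Fin n → F)),
    IsLRC C k r ∧ (minDist C : ℤ) = d}

/-- The assertion `𝒟(n, k, r) = d`: the largest minimum distance of an `(n, k, r)`-LRC exists
and is equal to `d`. -/
def LargestMinDistEq (n k r : ℕ) (d : ℤ) : Prop :=
  IsGreatest (minDistSet n k r) d

/-- `d* = n - k - ⌈k / r⌉ + 2`. -/
def dStar (n k r : ℕ) : ℤ := (n : ℤ) - k - ⌈(k : ℚ) / r⌉ + 2

/-- `k₁ = ⌈k / r⌉`. -/
def k₁ (k r : ℕ) : ℕ := ⌈(k : ℚ) / r⌉₊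

/-- `k₂ = k₁ r - k`; see `k₂_add` (the subtraction does not truncate). -/
def k₂ (k r : ℕ) : ℕ := k₁ k r * r - k

/-- `n₁ = ⌈n / (r + 1)⌉`. -/
def n₁ (n r : ℕ) : ℕ := ⌈(n : ℚ) / (r + 1)⌉₊

/-- `n₂ = n₁ (r + 1) - n`; see `n₂_add` (the subtraction does not truncate). -/
def n₂ (n r : ℕ) : ℕ := n₁ n r * (r + 1) - n

theorem k₂_add (k r : ℕ) (hr : 1 ≤ r) : k₂ k r + k = k₁ k r * r := by
  have h : (k : ℚ) / r ≤ k₁ k r := Nat.le_ceil _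
  rw [div_le_iff₀ (by exact_mod_cast hr)] at h
  exact Nat.sub_add_cancel (by exact_mod_cast h)

theorem n₂_add (n r : ℕ) : n₂ n r + n = n₁ n r * (r + 1) := by
  have h : (n : ℚ) / (r + 1) ≤ n₁ n r := Nat.le_ceil _
  rw [div_le_iff₀ (by positivity)] at h
  exact Nat.sub_add_cancel (by exact_mod_cast h)

/-! ### Multigraphs

Mathlib's `Graph α β` is the type of multigraphs; `H ≤ G` means that `H` is a subgraph of `G`. -/

/-- `G` has no subgraph of order `a` and size greater than `b`. -/
def HasNoDenseSubgraph {α β : Type*} (G : Graph α β) (a b : ℕ) : Prop :=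
  ∀ H : Graph α β, H ≤ G → V(H).encard = a → ¬ (b : ℕ∞) < E(H).encard

/-- The multigraph on `m` vertices with `b` parallel edges between every pair of (distinct)
vertices: the edges joining `x ≠ y` are `(s(x, y), 0), …, (s(x, y), b - 1)`. -/
def parallelComplete (m b : ℕ) : Graph (Fin m) (Sym2 (Fin m) × Fin b) where
  vertexSet := Set.univ
  IsLink e x y := x ≠ y ∧ e.1 = s(x, y)
  isLink_symm := fun _ _ => ⟨fun _ _ h => ⟨h.1.symm, h.2.trans Sym2.eq_swap⟩⟩
  eq_or_eq_of_isLink_of_isLink := by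
    rintro e x y v w ⟨-, h⟩ ⟨-, h'⟩
    have := h.symm.trans h'
    rw [Sym2.eq_iff] at this
    tauto
  left_mem_of_isLink := fun _ _ _ _ => Set.mem_univ _

theorem parallelComplete_loopless (m b : ℕ) : (parallelComplete m b).Loopless :=
  ⟨fun _ _ h => h.1 rfl⟩

theorem parallelComplete_order (m b : ℕ) : V(parallelComplete m b).encard = m := by
  simp [parallelComplete]

theorem parallelComplete_multiplicity (m b : ℕ) (u v : Fin m) (h : u ≠ v) :
    {e | (parallelComplete m b).IsLink e u v}.encard = b := by
  have : {e | (parallelComplete m b).IsLink e u v} =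
      (fun i : Fin b => (s(u, v), i)) '' Set.univ := by
    ext ⟨e, i⟩
    simp [parallelComplete, h, eq_comm]
  rw [this, Function.Injective.encard_image (fun i j hij => by simpa using hij)]
  simp

end LRC

namespace LRC

/-! ### Multigraphs without dense pairs of vertices -/

/-! If `k₁ = 2`, then `r < k ≤ 2r`, `d* = n - k` and `k + 2 = 2(r + 1) - k₂`; no code exceeds
distance `n - k` (`minDist_le`).

Necessity: at distance `n - k`, two distinct nonempty supports of dual words have a union of at
least `k + 2` points (`IsDualSupport.card_union`). Locality covers the coordinates by supports of
size at most `r + 1`, so at least `n₁` of them are distinct. Overlaps cost at most `k₂` per pair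
(`le_card_biUnion_add`), whence `n₁(r + 1) ≤ n + C(n₁, 2) k₂`.

Sufficiency: choose `n₂` edges of the multigraph. Vertices become blocks, each chosen edge a point
shared by its two end blocks, and private points pad every block to size `r + 1` (`exists_blocks`).
The blocks and `n - k - n₁` full rows form the support of a generic parity-check matrix. Hall's
theorem matches any fewer than `n - k` columns to rows (`exists_transversal`), so such columns are
independent and nonzero codewords have weight at least `n - k`. -/

theorem encard_edgeSet_le_of_vertexSet_pair {m b : ℕ} {H : Graph (Fin m) (Sym2 (Fin m) × Fin b)}
    (hH : H ≤ parallelComplete m b) {x y : Fin m} (hV : V(H) = {x, y}) :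
    E(H).encard ≤ b := by
  have hsub : E(H) ⊆ (fun i : Fin b => (s(x, y), i)) '' Set.univ := by
    intro e he
    obtain ⟨u, v, huv⟩ := H.exists_isLink_of_mem_edgeSet he
    have hu : u ∈ V(H) := huv.left_mem
    have hv : v ∈ V(H) := huv.right_mem
    obtain ⟨hne, h⟩ : u ≠ v ∧ e.1 = s(u, v) := hH.isLink_mono huv
    rw [hV, Set.mem_insert_iff, Set.mem_singleton_iff] at hu hv
    refine ⟨e.2, trivial, Prod.ext ?_ rfl⟩
    rw [h]
    rcases hu with rfl | rfl <;> rcases hv with rfl | rfl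
    · exact absurd rfl hne
    · rfl
    · exact Sym2.eq_swap
    · exact absurd rfl hne
  refine (Set.encard_le_encard hsub).trans ((Set.encard_image_le _ _).trans ?_)
  simp

theorem parallelComplete_hasNoDenseSubgraph (m b : ℕ) :
    HasNoDenseSubgraph (parallelComplete m b) 2 b := by
  intro H hH hV
  obtain ⟨x, y, -, hxy⟩ := Set.encard_eq_two.mp hV
  exact not_lt.mpr (encard_edgeSet_le_of_vertexSet_pair hH hxy)

theorem parallelComplete_size (m b : ℕ) :
    E(parallelComplete m b).encard = ((m.choose 2 * b : ℕ) : ℕ∞) := by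
  classical
  have hE : E(parallelComplete m b) =
      ((({a : Sym2 (Fin m) | ¬ a.IsDiag} : Finset _) ×ˢ (Finset.univ : Finset (Fin b)) :
        Finset (Sym2 (Fin m) × Fin b)) : Set (Sym2 (Fin m) × Fin b)) := by
    ext ⟨e, i⟩
    rw [Graph.edge_mem_iff_exists_isLink]
    induction e with
    | _ u v =>
      simp only [parallelComplete, Finset.coe_product, Finset.coe_univ, Set.mem_prod,
        Finset.mem_coe, Finset.mem_filter, Finset.mem_univ, true_and, Sym2.mk_isDiag_iff,
        Set.mem_univ, and_true]
      constructor
      · rintro ⟨x, y, hne, h⟩ rfl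
        rw [Sym2.eq_iff] at h
        rcases h with ⟨rfl, rfl⟩ | ⟨rfl, rfl⟩ <;> exact hne rfl
      · exact fun h => ⟨u, v, h, rfl⟩
  rw [hE, Set.encard_coe_eq_coe_finsetCard, Finset.card_product, Finset.card_univ,
    Fintype.card_fin, ← Fintype.card_subtype, Sym2.card_subtype_not_diag, Fintype.card_fin]

/-- Without loops every edge lies in the subgraph induced on some pair of vertices, and each such
subgraph has at most `b` edges. -/
theorem encard_edgeSet_le {α β : Type*} {G : Graph α β} (hG : G.Loopless) {m b : ℕ}
    (hV : V(G).encard = m) (h : HasNoDenseSubgraph G 2 b) :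
    E(G).encard ≤ ((m.choose 2 * b : ℕ) : ℕ∞) := by
  classical
  have hfin : V(G).Finite := Set.finite_of_encard_eq_coe hV
  set A : Finset α := hfin.toFinset with hA
  have hAcard : A.card = m := by
    rw [hfin.encard_eq_coe_toFinset_card] at hV
    exact_mod_cast hV
  have hne : ∀ {e x y}, G.IsLink e x y → x ≠ y := by
    rintro e x y hl rfl
    exact hG.not_isLoopAt e x hl
  have hsub : E(G) ⊆ ⋃ q ∈ A.powersetCard 2, {e | ∃ x y, G.IsLink e x y ∧ x ∈ q ∧ y ∈ q} := by
    intro e he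
    obtain ⟨x, y, hxy⟩ := G.exists_isLink_of_mem_edgeSet he
    refine Set.mem_biUnion (x := ({x, y} : Finset α)) ?_ ⟨x, y, hxy, by simp, by simp⟩
    rw [Finset.mem_coe, Finset.mem_powersetCard]
    refine ⟨?_, Finset.card_pair (hne hxy)⟩
    intro z hz
    rw [Finset.mem_insert, Finset.mem_singleton] at hz
    rcases hz with rfl | rfl
    · simpa [hA] using hxy.left_mem
    · simpa [hA] using hxy.right_mem
  have hq : ∀ q ∈ A.powersetCard 2,
      {e | ∃ x y, G.IsLink e x y ∧ x ∈ q ∧ y ∈ q}.encard ≤ b := by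
    intro q hq
    rw [Finset.mem_powersetCard] at hq
    have hqV : (q : Set α) ⊆ V(G) := fun x hx => by simpa [hA] using hq.1 hx
    have := h (G.induce q) (Graph.induce_le hqV)
      (by change (q : Set α).encard = _
          rw [Set.encard_coe_eq_coe_finsetCard, hq.2])
    exact not_lt.mp this
  refine (Set.encard_le_encard hsub).trans ((Finset.set_encard_biUnion_le _ _).trans
    ((Finset.sum_le_sum hq).trans ?_))
  rw [Finset.sum_const, Finset.card_powersetCard, hAcard, nsmul_eq_mul, Nat.cast_mul]

/-! ### Minimum distance and vanishing of codewords -/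

section Code

variable {F : Type*} [Field F] {n : ℕ} {C : Submodule F (Fin n → F)}

theorem exists_mem_ne_zero_vanishing {U : Finset (Fin n)} (h : U.card < Module.finrank F C) :
    ∃ c ∈ C, c ≠ 0 ∧ ∀ j ∈ U, c j = 0 := by
  let f : C →ₗ[F] (U → F) := (LinearMap.funLeft F F (Subtype.val : U → Fin n)).comp C.subtype
  have hker : LinearMap.ker f ≠ ⊥ := f.ker_ne_bot_of_finrank_lt (by simpa using h)
  obtain ⟨c, hc, hne⟩ := Submodule.exists_mem_ne_zero_of_ne_bot hker
  refine ⟨c, c.2, by simpa using hne, fun j hj => ?_⟩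
  exact congrFun (LinearMap.mem_ker.mp hc) ⟨j, hj⟩

theorem hammingNorm_add_card_le [DecidableEq F] {c : Fin n → F} {T : Finset (Fin n)}
    (h : ∀ j ∈ T, c j = 0) : hammingNorm c + T.card ≤ n := by
  have hd : Disjoint ({j | c j ≠ 0} : Finset (Fin n)) T := by
    rw [Finset.disjoint_left]
    intro j hj hjT
    exact (Finset.mem_filter.mp hj).2 (h j hjT)
  rw [hammingNorm, ← Finset.card_union_of_disjoint hd]
  exact card_finset_fin_le _

theorem minDist_le_hammingNorm [DecidableEq F] {c : Fin n → F} (hc : c ∈ C) (h0 : c ≠ 0) :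
    minDist C ≤ hammingNorm c :=
  Nat.sInf_le ⟨c, hc, 0, C.zero_mem, h0, hammingDist_zero_right c⟩

theorem le_minDist [DecidableEq F] {d : ℕ} (hC : 0 < Module.finrank F C)
    (h : ∀ c ∈ C, c ≠ 0 → d ≤ hammingNorm c) : d ≤ minDist C := by
  obtain ⟨c, hc, h0, -⟩ := exists_mem_ne_zero_vanishing (C := C) (U := ∅) (by simpa using hC)
  refine le_csInf ⟨_, c, hc, 0, C.zero_mem, h0, rfl⟩ ?_
  rintro _ ⟨x, hx, y, hy, hxy, rfl⟩
  rw [hammingDist_comm, hammingDist_eq_hammingNorm, neg_add_eq_sub]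
  exact h _ (C.sub_mem hx hy) (sub_ne_zero.mpr hxy)

theorem eq_zero_of_vanishing [DecidableEq F] {c : Fin n → F} {T : Finset (Fin n)} (hc : c ∈ C)
    (hT : n < minDist C + T.card) (h : ∀ j ∈ T, c j = 0) : c = 0 := by
  by_contra h0
  have h1 := minDist_le_hammingNorm hc h0
  have h2 := hammingNorm_add_card_le h
  omega

/-- The Singleton-type bound in the case `r < k`. -/
theorem minDist_le [DecidableEq F] {k r : ℕ} (hrk : r < k) (hkn : k ≤ n) (hC : IsLRC C k r) :
    minDist C ≤ n - k := by
  by_contra! hd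
  obtain ⟨hk, hloc⟩ := hC
  obtain ⟨S, hiS, hS, a, ha⟩ := hloc ⟨0, by omega⟩
  set i : Fin n := ⟨0, by omega⟩
  -- `k - 1` zeros on `T` force the `k`-th one at `i`, since the repair set of `i` lies in `T`.
  obtain ⟨T, hST, hT⟩ := Finset.exists_superset_card_eq (s := insert i S) (n := k)
    (by rw [Finset.card_insert_of_notMem hiS]; omega) (by simpa using hkn)
  have hiT : i ∈ T := hST (Finset.mem_insert_self i S)
  obtain ⟨c, hc, h0, hcv⟩ := exists_mem_ne_zero_vanishing (C := C) (U := T.erase i)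
    (by rw [Finset.card_erase_of_mem hiT]; omega)
  refine h0 (eq_zero_of_vanishing hc (T := T) (by omega) fun j hj => ?_)
  rcases eq_or_ne j i with rfl | hji
  · rw [ha c hc]
    refine Finset.sum_eq_zero fun l hl => ?_
    rw [hcv l (Finset.mem_erase.mpr ⟨fun h => hiS (h ▸ hl), hST (Finset.mem_insert_of_mem hl)⟩),
      mul_zero]
  · exact hcv j (Finset.mem_erase.mpr ⟨hji, hj⟩)

/-- `A` is the support of a dual codeword of `C`. -/
def IsDualSupport (C : Submodule F (Fin n → F)) (A : Finset (Fin n)) : Prop :=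
  ∃ w : Fin n → F, (∀ j, w j ≠ 0 ↔ j ∈ A) ∧ ∀ c ∈ C, ∑ j, w j * c j = 0

/-- Taking the exact support drops zero coefficients, so every point of it, not only `i`, is
recoverable from the others. -/
theorem HasLocality.exists_isDualSupport {r : ℕ} (h : HasLocality C r) (i : Fin n) :
    ∃ A : Finset (Fin n), i ∈ A ∧ A.card ≤ r + 1 ∧ IsDualSupport C A := by
  classical
  obtain ⟨S, hiS, hS, a, ha⟩ := h i
  set w : Fin n → F := fun j => (if j = i then 1 else 0) - if j ∈ S then a j else 0 with hw
  refine ⟨Finset.univ.filter fun j => w j ≠ 0, by simp [hw, hiS], ?_, w, by simp, fun c hc => ?_⟩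
  · refine (Finset.card_le_card (t := insert i S) fun j hj => ?_).trans
      ((Finset.card_insert_le _ _).trans (by omega))
    by_contra hjS
    rw [Finset.mem_insert, not_or] at hjS
    simp [hw, hjS] at hj
  · simp [hw, sub_mul, Finset.sum_sub_distrib, ha c hc]

theorem IsDualSupport.apply_eq_zero {A : Finset (Fin n)} (hA : IsDualSupport C A) {c : Fin n → F}
    (hc : c ∈ C) {p : Fin n} (hp : p ∈ A) (h : ∀ j ∈ A, j ≠ p → c j = 0) : c p = 0 := by
  obtain ⟨w, hw, hwc⟩ := hA
  have := hwc c hc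
  rw [Finset.sum_eq_single p (fun j _ hj => ?_) (by simp)] at this
  · exact (mul_eq_zero.mp this).resolve_left ((hw p).mpr hp)
  · by_cases hjA : j ∈ A
    · rw [h j hjA hj, mul_zero]
    · rw [not_not.mp (mt (hw j).mp hjA), zero_mul]

/-- Otherwise `A ∪ B` fits into a set `T` of `k + 1` points, where `k` is the dimension. A nonzero
word vanishing on `T` except at `p ∈ A \ B` and `q ∈ B` exists; `B` avoids `p` and so forces a zero
at `q`, then `A` forces one at `p`. The weight is then below `n - k`. -/
theorem IsDualSupport.card_union_of_not_subset [DecidableEq F] {A B : Finset (Fin n)}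
    (hA : IsDualSupport C A) (hB : IsDualSupport C B) (hAB : ¬ A ⊆ B) (hB0 : B.Nonempty)
    (hkn : Module.finrank F C < n) (hd : n - Module.finrank F C ≤ minDist C) :
    Module.finrank F C + 2 ≤ (A ∪ B).card := by
  by_contra! hlt
  obtain ⟨p, hpA, hpB⟩ := Finset.not_subset.mp hAB
  obtain ⟨q, hqB⟩ := hB0
  have hqp : q ≠ p := fun h => hpB (h ▸ hqB)
  obtain ⟨T, hT, hTc⟩ := Finset.exists_superset_card_eq (s := A ∪ B)
    (n := Module.finrank F C + 1) (by omega) (by simpa using hkn)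
  have hpT : p ∈ T := hT (Finset.mem_union_left _ hpA)
  have hqT : q ∈ T := hT (Finset.mem_union_right _ hqB)
  have hcard : ((T.erase p).erase q).card + 2 = T.card := by
    have h1 := Finset.card_erase_add_one hpT
    have h2 := Finset.card_erase_add_one (Finset.mem_erase.mpr ⟨hqp, hqT⟩)
    omega
  obtain ⟨c, hc, h0, hcv⟩ := exists_mem_ne_zero_vanishing (C := C) (U := (T.erase p).erase q)
    (by omega)
  have hcv' : ∀ j ∈ T, j ≠ p → j ≠ q → c j = 0 := fun j hj hp hq =>
    hcv j (Finset.mem_erase.mpr ⟨hq, Finset.mem_erase.mpr ⟨hp, hj⟩⟩)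
  have hq0 : c q = 0 := hB.apply_eq_zero hc hqB fun j hj hjq =>
    hcv' j (hT (Finset.mem_union_right _ hj)) (fun h => hpB (h ▸ hj)) hjq
  have hq1 : ∀ j ∈ T, j ≠ p → c j = 0 := fun j hj hjp => by
    rcases eq_or_ne j q with rfl | hjq
    exacts [hq0, hcv' j hj hjp hjq]
  have hp0 : c p = 0 := hA.apply_eq_zero hc hpA fun j hj hjp =>
    hq1 j (hT (Finset.mem_union_left _ hj)) hjp
  refine h0 (eq_zero_of_vanishing hc (T := T) (by omega) fun j hj => ?_)
  rcases eq_or_ne j p with rfl | hjp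
  exacts [hp0, hq1 j hj hjp]

theorem IsDualSupport.card_union [DecidableEq F] {A B : Finset (Fin n)}
    (hA : IsDualSupport C A) (hB : IsDualSupport C B) (hAB : A ≠ B) (hA0 : A.Nonempty)
    (hB0 : B.Nonempty) (hkn : Module.finrank F C < n)
    (hd : n - Module.finrank F C ≤ minDist C) :
    Module.finrank F C + 2 ≤ (A ∪ B).card := by
  by_cases h : A ⊆ B
  · rw [Finset.union_comm]
    exact hB.card_union_of_not_subset hA (fun h' => hAB (h.antisymm h')) hA0 hkn hd
  · exact hA.card_union_of_not_subset hB h hB0 hkn hd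

end Code

/-- Induction from two sets, as the union hypothesis says nothing about a single one. A set smaller
than `s` by `δ` meets each other set in at most `b - δ` points, so its deficit is recovered by one
intersection. -/
theorem le_card_biUnion_add {α : Type*} [DecidableEq α] {b s l : ℕ} (hl : l + b = 2 * s)
    (𝒜 : Finset (Finset α)) (hcard : ∀ A ∈ 𝒜, A.card ≤ s)
    (hunion : ∀ A ∈ 𝒜, ∀ B ∈ 𝒜, A ≠ B → l ≤ (A ∪ B).card) (h2 : 2 ≤ 𝒜.card) :
    𝒜.card * s ≤ (𝒜.biUnion id).card + 𝒜.card.choose 2 * b := by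
  induction 𝒜 using Finset.induction_on with
  | empty => simp at h2
  | insert A 𝒮 hA ih =>
    rw [Finset.card_insert_of_notMem hA] at h2 ⊢
    have hAB : ∀ B ∈ 𝒮, A ≠ B := fun B hB h => hA (h ▸ hB)
    have hU : ∀ B ∈ 𝒮, l ≤ (A ∪ B).card := fun B hB =>
      hunion A (Finset.mem_insert_self _ _) B (Finset.mem_insert_of_mem hB) (hAB B hB)
    rcases (show 𝒮.card = 1 ∨ 2 ≤ 𝒮.card by omega) with h1 | h1
    · obtain ⟨B, rfl⟩ := Finset.card_eq_one.mp h1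
      have := hU B (Finset.mem_singleton_self B)
      simp only [Finset.card_singleton, Finset.biUnion_insert, Finset.singleton_biUnion, id]
      norm_num
      omega
    · have ih' := ih (fun B hB => hcard B (Finset.mem_insert_of_mem hB))
        (fun B hB D hD => hunion B (Finset.mem_insert_of_mem hB) D (Finset.mem_insert_of_mem hD)) h1
      have hAs := hcard A (Finset.mem_insert_self _ _)
      have hint : (A ∩ 𝒮.biUnion id).card ≤ ∑ B ∈ 𝒮, (A ∩ B).card := by
        rw [Finset.inter_biUnion]
        exact Finset.card_biUnion_le
      have hpair : ∀ B ∈ 𝒮, (A ∩ B).card + s ≤ A.card + b := fun B hB => by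
        have h3 := Finset.card_union_add_card_inter A B
        have h4 := hU B hB
        have h5 := hcard B (Finset.mem_insert_of_mem hB)
        omega
      have hsum : ∑ B ∈ 𝒮, (A ∩ B).card + 𝒮.card * s ≤ 𝒮.card * A.card + 𝒮.card * b := by
        have := Finset.sum_le_sum hpair
        simpa [Finset.sum_add_distrib, mul_add] using this
      have hcu := Finset.card_union_add_card_inter A (𝒮.biUnion id)
      rw [Finset.biUnion_insert, Nat.choose_succ_succ' 𝒮.card 1, Nat.choose_one_right]
      simp only [id]
      obtain ⟨δ, hδ⟩ := Nat.exists_eq_add_of_le hAs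
      have hmul : δ ≤ 𝒮.card * δ := Nat.le_mul_of_pos_left δ (by omega)
      subst hδ
      nlinarith

/-! ### Blocks with small pairwise intersections -/

theorem exists_blocks {m s b t n : ℕ} (hn : t + n = m * s) (ht : t ≤ m.choose 2 * b)
    (hts : t ≤ s) :
    ∃ S : Fin m → Finset (Fin n), (∀ i, (S i).card = s) ∧ (∀ j, ∃ i, j ∈ S i) ∧
      ∀ i i', i ≠ i' → (S i ∩ S i').card ≤ b := by
  classical
  obtain ⟨g⟩ : Nonempty (Fin t ↪ {a : Sym2 (Fin m) // ¬ a.IsDiag} × Fin b) := by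
    apply Function.Embedding.nonempty_of_card_le
    rwa [Fintype.card_prod, Sym2.card_subtype_not_diag, Fintype.card_fin, Fintype.card_fin,
      Fintype.card_fin]
  let I : Fin m → Finset (Fin t) := fun i => {e | i ∈ (g e).1.1}
  have hIt : ∀ i, (I i).card ≤ s := fun i => (card_finset_fin_le _).trans hts
  have hdeg : ∑ i, (I i).card = 2 * t := by
    have h := Finset.sum_card_bipartiteAbove_eq_sum_card_bipartiteBelow
      (s := (Finset.univ : Finset (Fin m))) (t := (Finset.univ : Finset (Fin t)))
      (r := fun i e => i ∈ (g e).1.1)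
    have h2 : ∀ e : Fin t, (Finset.bipartiteBelow (fun i e => i ∈ (g e).1.1)
        (Finset.univ : Finset (Fin m)) e).card = 2 := fun e => by
      rw [← Sym2.card_toFinset_of_not_isDiag _ (g e).1.2]
      congr 1
      ext i
      simp [Finset.bipartiteBelow]
    rw [Finset.sum_congr rfl fun e _ => h2 e, Finset.sum_const, Finset.card_univ,
      Fintype.card_fin, smul_eq_mul, mul_comm] at h
    exact h
  -- Chosen edges and private padding; by the handshake identity `hdeg` there are `t + (m s - 2t) =
  -- n` points.
  let P : Type := Fin t ⊕ Σ i : Fin m, Fin (s - (I i).card)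
  have hP : Fintype.card P = n := by
    have h1 : ∑ i, (s - (I i).card) + ∑ i, (I i).card = m * s := by
      rw [← Finset.sum_add_distrib, Finset.sum_congr rfl fun i _ => Nat.sub_add_cancel (hIt i)]
      simp
    simp only [P, Fintype.card_sum, Fintype.card_sigma, Fintype.card_fin]
    omega
  let φ : P ≃ Fin n := Fintype.equivFinOfCardEq hP
  let T : Fin m → Finset P := fun i =>
    (I i).disjSum (Finset.univ.map (Function.Embedding.sigmaMk i))
  have hTl : ∀ i e, (Sum.inl e : P) ∈ T i ↔ i ∈ (g e).1.1 := fun i e =>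
    Finset.inl_mem_disjSum.trans (by simp [I])
  have hTr : ∀ i l x, (Sum.inr ⟨l, x⟩ : P) ∈ T i ↔ l = i := fun i l x => by
    refine Finset.inr_mem_disjSum.trans ?_
    rw [Finset.mem_map]
    constructor
    · rintro ⟨_, _, h⟩
      exact (congrArg Sigma.fst h).symm
    · rintro rfl
      exact ⟨x, Finset.mem_univ _, rfl⟩
  refine ⟨fun i => (T i).map φ.toEmbedding, fun i => ?_, fun j => ?_, fun i i' hii => ?_⟩
  · rw [Finset.card_map, Finset.card_disjSum, Finset.card_map, Finset.card_univ, Fintype.card_fin]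
    exact Nat.add_sub_cancel' (hIt i)
  · obtain ⟨p, rfl⟩ := φ.surjective j
    simp only [Finset.mem_map_equiv, Equiv.symm_apply_apply]
    rcases p with e | ⟨i, x⟩
    · obtain ⟨i, hi⟩ : ∃ i, i ∈ (g e).1.1 := ⟨_, Sym2.out_fst_mem _⟩
      exact ⟨i, (hTl i e).mpr hi⟩
    · exact ⟨i, (hTr i i x).mpr rfl⟩
  · rw [← Finset.map_inter, Finset.card_map]
    have hmem : ∀ p ∈ T i ∩ T i', ∃ e : Fin t, p = Sum.inl e ∧ (g e).1.1 = s(i, i') := by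
      intro p hp
      rw [Finset.mem_inter] at hp
      rcases p with e | ⟨l, x⟩
      · exact ⟨e, rfl, (Sym2.mem_and_mem_iff hii).mp ⟨(hTl _ _).mp hp.1, (hTl _ _).mp hp.2⟩⟩
      · exact absurd (((hTr _ _ _).mp hp.1).symm.trans ((hTr _ _ _).mp hp.2)) hii
    -- A point common to two blocks is an edge joining them, determined by its label in `Fin b`.
    have hcard := Finset.card_le_card_of_forall_subsingleton
      (s := T i ∩ T i') (t := (Finset.univ : Finset (Fin b)))
      (fun p x => ∃ e : Fin t, p = Sum.inl e ∧ (g e).1.1 = s(i, i') ∧ (g e).2 = x)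
      (fun p hp => by
        obtain ⟨e, rfl, he⟩ := hmem p hp
        exact ⟨(g e).2, Finset.mem_univ _, e, rfl, he, rfl⟩)
      (by
        rintro x - _ ⟨-, e, rfl, he, hx⟩ _ ⟨-, e', rfl, he', hx'⟩
        rw [g.injective (Prod.ext (Subtype.ext (he.trans he'.symm)) (hx.trans hx'.symm))])
    simpa using hcard

/-! ### Generic matrices with prescribed support -/

/-- Over some prime field there is a matrix with support exactly `{(i, j) | j ∈ B i}` all of whose
minors that contain a transversal in this support, on the diagonal, are nonzero. -/
theorem exists_generic_matrix {ι κ : Type*} [Fintype ι] [Fintype κ] [DecidableEq ι]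
    [DecidableEq κ] (B : ι → Finset κ) :
    ∃ (p : ℕ) (_ : Fact p.Prime) (M : Matrix ι κ (ZMod p)), (∀ i j, M i j ≠ 0 ↔ j ∈ B i) ∧
      ∀ (J : Finset κ) (f : J → ι), Function.Injective f → (∀ j, (j : κ) ∈ B (f j)) →
        (M.submatrix f ((↑) : J → κ)).det ≠ 0 := by
  classical
  let X : Matrix ι κ (MvPolynomial (ι × κ) ℤ) := fun i j =>
    if j ∈ B i then MvPolynomial.X (i, j) else 0
  have hX : ∀ i j, X i j = if j ∈ B i then MvPolynomial.X (i, j) else 0 := fun _ _ => rfl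
  let A : Type _ := Σ J : Finset κ, {f : J → ι // Function.Injective f ∧ ∀ j, (j : κ) ∈ B (f j)}
  let D : A → MvPolynomial (ι × κ) ℤ := fun a =>
    (X.submatrix a.2.1 ((↑) : a.1 → κ)).det
  have hD : ∀ a, D a ≠ 0 := by
    rintro ⟨J, f, hf, hfB⟩ h0
    -- Setting the transversal's variables to 1 and all others to 0 turns the minor into the
    -- identity.
    have h1 : ((X.submatrix f ((↑) : J → κ)).map
        (MvPolynomial.eval fun q : ι × κ => if ∃ j : J, f j = q.1 ∧ (j : κ) = q.2 then 1 else 0)) =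
        (1 : Matrix J J ℤ) := by
      ext j j'
      by_cases hjj : j = j'
      · subst hjj
        rw [Matrix.map_apply, Matrix.submatrix_apply, hX, if_pos (hfB j), MvPolynomial.eval_X,
          if_pos ⟨j, rfl, rfl⟩, Matrix.one_apply_eq]
      · have : ¬ ∃ l : J, f l = f j ∧ (l : κ) = j' := by
          rintro ⟨l, hl, hl'⟩
          exact hjj ((hf hl).symm.trans (Subtype.ext hl'))
        rw [Matrix.map_apply, Matrix.submatrix_apply, Matrix.one_apply_ne hjj, hX]
        split_ifs
        · rw [MvPolynomial.eval_X, if_neg this]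
        · exact map_zero _
    have h2 := congrArg Matrix.det h1
    rw [← RingHom.mapMatrix_apply, ← RingHom.map_det] at h2
    change MvPolynomial.eval _ (D ⟨J, f, hf, hfB⟩) = _ at h2
    rw [h0, map_zero, Matrix.det_one] at h2
    exact zero_ne_one h2
  -- One nonzero value of `Q`, reduced modulo a larger prime, keeps all these minors and all entries
  -- on the support nonzero.
  let Q : MvPolynomial (ι × κ) ℤ := (∏ a, D a) * ∏ q : ι × κ, MvPolynomial.X q
  have hQ : Q ≠ 0 := mul_ne_zero (Finset.prod_ne_zero_iff.mpr fun a _ => hD a)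
    (Finset.prod_ne_zero_iff.mpr fun q _ => MvPolynomial.X_ne_zero q)
  obtain ⟨x, hx⟩ : ∃ x, MvPolynomial.eval x Q ≠ 0 := by
    by_contra! h
    exact hQ (MvPolynomial.funext fun x => by rw [h x, map_zero])
  obtain ⟨p, hp, hpp⟩ := Nat.exists_infinite_primes ((MvPolynomial.eval x Q).natAbs + 1)
  have : Fact p.Prime := ⟨hpp⟩
  let ψ : MvPolynomial (ι × κ) ℤ →+* ZMod p := (Int.castRingHom (ZMod p)).comp (MvPolynomial.eval x)
  have hψQ : ψ Q ≠ 0 := by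
    change ((MvPolynomial.eval x Q : ℤ) : ZMod p) ≠ 0
    rw [Ne, ZMod.intCast_zmod_eq_zero_iff_dvd, Int.natCast_dvd]
    intro hdvd
    have := Nat.le_of_dvd (Int.natAbs_pos.mpr hx) hdvd
    omega
  rw [map_mul, map_prod, map_prod] at hψQ
  have hψD := Finset.prod_ne_zero_iff.mp (left_ne_zero_of_mul hψQ)
  have hψX := Finset.prod_ne_zero_iff.mp (right_ne_zero_of_mul hψQ)
  refine ⟨p, inferInstance, X.map ψ, fun i j => ?_, fun J f hf hfB => ?_⟩
  · rw [Matrix.map_apply, hX]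
    by_cases hj : j ∈ B i
    · simpa [hj] using hψX (i, j) (Finset.mem_univ _)
    · simp [hj]
  · have := hψD ⟨J, f, hf, hfB⟩ (Finset.mem_univ _)
    rwa [RingHom.map_det] at this

/-- A subspace contains subspaces of every smaller dimension. -/
theorem exists_submodule_le_finrank_eq {F V : Type*} [Field F] [AddCommGroup V] [Module F V]
    [FiniteDimensional F V] (W : Submodule F V) {k : ℕ} (h : k ≤ Module.finrank F W) :
    ∃ C ≤ W, Module.finrank F C = k := by
  obtain ⟨s, hs, hli⟩ := exists_finset_linearIndependent_of_le_finrank h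
  refine ⟨(Submodule.span F (s : Set W)).map W.subtype, Submodule.map_subtype_le _ _, ?_⟩
  rw [(Submodule.equivMapOfInjective _ W.subtype_injective _).symm.finrank_eq,
    finrank_span_finset_eq_card hli, hs]

/-! ### Codes from blocks -/

/-- A transversal of few columns in a support that consists of blocks, any two or more of which
have a large union, and of full rows. -/
theorem exists_transversal {m n k l : ℕ} {B : Fin m → Finset (Fin n)} (hl : n = k + m + l)
    (hB : ∀ I : Finset (Fin m), 2 ≤ I.card → k + I.card ≤ (I.biUnion B).card)
    {J : Finset (Fin n)} (hJ : J.card + k < n) :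
    ∃ f : J → Fin m ⊕ Fin l, Function.Injective f ∧
      ∀ j, (j : Fin n) ∈ (Sum.elim B fun _ => Finset.univ : Fin m ⊕ Fin l → Finset (Fin n)) (f j) := by
  classical
  set B' : Fin m ⊕ Fin l → Finset (Fin n) := Sum.elim B fun _ => Finset.univ with hB'
  have hall : ∀ A : Finset J,
      A.card ≤ (A.biUnion fun j => Finset.univ.filter fun i => (j : Fin n) ∈ B' i).card := by
    intro A
    rcases A.eq_empty_or_nonempty with rfl | ⟨a, ha⟩
    · simp
    let I : Finset (Fin m) := {i | ∀ j ∈ A, (j : Fin n) ∉ B i}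
    set N := A.biUnion fun j => Finset.univ.filter fun i => (j : Fin n) ∈ B' i with hN
    have hN' : m + l ≤ N.card + I.card := by
      have huniv : (Finset.univ : Finset (Fin m ⊕ Fin l)) ⊆ N ∪ I.map Function.Embedding.inl := by
        rintro (i | i) -
        · by_cases hi : i ∈ I
          · exact Finset.mem_union_right _ (Finset.mem_map_of_mem _ hi)
          · refine Finset.mem_union_left _ ?_
            simp only [I, Finset.mem_filter, Finset.mem_univ, true_and, not_forall, not_not] at hi
            obtain ⟨j, hj, hji⟩ := hi
            exact Finset.mem_biUnion.mpr ⟨j, hj, by simpa [hB'] using hji⟩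
        · exact Finset.mem_union_left _ (Finset.mem_biUnion.mpr ⟨a, ha, by simp [hB']⟩)
      have h1 := (Finset.card_le_card huniv).trans (Finset.card_union_le _ _)
      simpa using h1
    -- `I` collects the block rows missing `A`. If there is at most one, `n - k - 1 ≥ |J|` rows
    -- remain; otherwise `A` avoids their union, so `|A| ≤ n - k - |I|`.
    rcases Nat.lt_or_ge I.card 2 with hI | hI
    · have hAJ : A.card ≤ J.card := by simpa using Finset.card_le_univ A
      omega
    · have hdisj : Disjoint (A.map (Function.Embedding.subtype _)) (I.biUnion B) := by
        rw [Finset.disjoint_left]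
        intro x hx hxI
        obtain ⟨j, hj, rfl⟩ := Finset.mem_map.mp hx
        obtain ⟨i, hi, hji⟩ := Finset.mem_biUnion.mp hxI
        exact (Finset.mem_filter.mp hi).2 j hj hji
      have h1 := card_finset_fin_le (A.map (Function.Embedding.subtype _) ∪ I.biUnion B)
      rw [Finset.card_union_of_disjoint hdisj, Finset.card_map] at h1
      have h2 := hB I hI
      omega
  obtain ⟨f, hf, hfB⟩ := (Finset.all_card_le_biUnion_card_iff_exists_injective _).mp hall
  exact ⟨f, hf, fun j => (Finset.mem_filter.mp (hfB j)).2⟩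

theorem exists_isLRC {m n k r : ℕ} (hk : 0 < k) (B : Fin m → Finset (Fin n))
    (hcard : ∀ i, (B i).card ≤ r + 1) (hcover : ∀ j, ∃ i, j ∈ B i) (hmn : k + m ≤ n)
    (hB : ∀ I : Finset (Fin m), 2 ≤ I.card → k + I.card ≤ (I.biUnion B).card) :
    ∃ (p : ℕ) (_ : Fact p.Prime) (C : Submodule (ZMod p) (Fin n → ZMod p)),
      IsLRC C k r ∧ n - k ≤ minDist C := by
  classical
  obtain ⟨l, hl⟩ := Nat.exists_eq_add_of_le hmn
  obtain ⟨p, hp, M, hM, hdet⟩ := exists_generic_matrix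
    (Sum.elim B fun _ => Finset.univ : Fin m ⊕ Fin l → Finset (Fin n))
  -- `M` has `m + l = n - k` rows; its kernel might exceed dimension `k`, hence the passage to a
  -- subspace.
  have hker : k ≤ Module.finrank (ZMod p) (LinearMap.ker M.mulVecLin) := by
    have h1 := M.mulVecLin.finrank_range_add_finrank_ker
    have h2 := (LinearMap.range M.mulVecLin).finrank_le
    simp only [Module.finrank_fintype_fun_eq_card, Fintype.card_sum, Fintype.card_fin] at h1 h2
    omega
  obtain ⟨C, hC, hCk⟩ := exists_submodule_le_finrank_eq _ hker
  have hCM : ∀ c ∈ C, ∀ i, ∑ j, M i j * c j = 0 := fun c hc i => congrFun (hC hc) i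
  refine ⟨p, hp, C, ⟨hCk, fun j => ?_⟩, le_minDist (by omega) fun c hc h0 => ?_⟩
  · obtain ⟨i, hi⟩ := hcover j
    refine ⟨(B i).erase j, Finset.notMem_erase _ _, ?_,
      fun l => -(M (Sum.inl i) j)⁻¹ * M (Sum.inl i) l, fun c hc => ?_⟩
    · rw [Finset.card_erase_of_mem hi]
      have := hcard i
      omega
    · have h1 := hCM c hc (Sum.inl i)
      rw [← Finset.sum_subset (Finset.subset_univ (B i)) fun l _ hl => by
        rw [not_not.mp (mt (hM (Sum.inl i) l).mp hl), zero_mul], ← Finset.add_sum_erase _ _ hi] at h1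
      simp only [mul_assoc]
      rw [← Finset.mul_sum, eq_neg_of_add_eq_zero_right h1, neg_mul_neg,
        inv_mul_cancel_left₀ ((hM (Sum.inl i) j).mpr hi)]
  · by_contra! hlt
    set J : Finset (Fin n) := {j | c j ≠ 0} with hJ
    have hJc : J.card = hammingNorm c := rfl
    obtain ⟨f, hf, hfB⟩ := exists_transversal (J := J) hl hB (by omega)
    have hv : (M.submatrix f ((↑) : J → Fin n)).mulVec (fun j => c j) = 0 := by
      funext i
      have h1 := hCM c hc (f i)
      rw [← Finset.sum_subset (Finset.subset_univ J) fun l _ hl => by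
        rw [show c l = 0 by simpa [hJ] using hl, mul_zero], ← Finset.sum_coe_sort J] at h1
      exact h1
    have hz := Matrix.eq_zero_of_mulVec_eq_zero (hdet J f hf hfB) hv
    refine h0 (funext fun j => ?_)
    by_contra hj
    exact hj (congrFun hz ⟨j, by simpa [hJ] using hj⟩)

/-! ### The parameters of the problem -/

theorem n₂_le (n r : ℕ) : n₂ n r ≤ r := by
  have h1 := n₂_add n r
  have h2 : (n₁ n r : ℚ) < (n : ℚ) / (r + 1) + 1 := Nat.ceil_lt_add_one (by positivity)
  rw [div_add_one (by positivity), lt_div_iff₀ (by positivity)] at h2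
  have h3 : n₁ n r * (r + 1) < n + (r + 1) := by exact_mod_cast h2
  omega

theorem n₁_le {n r a : ℕ} (h : n ≤ a * (r + 1)) : n₁ n r ≤ a := by
  refine Nat.ceil_le.mpr ?_
  rw [div_le_iff₀ (by positivity)]
  exact_mod_cast h

theorem lt_of_one_lt_k₁ {k r : ℕ} (hr : 1 ≤ r) (h : 1 < k₁ k r) : r < k := by
  have h1 : ((1 : ℕ) : ℚ) < (k : ℚ) / r := Nat.lt_ceil.mp h
  rw [lt_div_iff₀ (by exact_mod_cast hr)] at h1
  simpa using h1

theorem dStar_eq_of_k₁_eq_two {n k r : ℕ} (h : k₁ k r = 2) (hkn : k ≤ n) :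
    dStar n k r = ((n - k : ℕ) : ℤ) := by
  have h1 : (⌈(k : ℚ) / r⌉ : ℤ) = 2 := by
    rw [← Int.natCast_ceil_eq_ceil (by positivity)]
    exact_mod_cast h
  rw [dStar, h1, Nat.cast_sub hkn]
  ring

/-- The unions of two or more blocks are large. -/
theorem add_card_le_card_biUnion {m n k r b : ℕ} {B : Fin m → Finset (Fin n)}
    (hcard : ∀ i, (B i).card = r + 1) (hcover : ∀ j, ∃ i, j ∈ B i)
    (hinter : ∀ i i', i ≠ i' → (B i ∩ B i').card ≤ b) (hb : b + k = 2 * r)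
    (hn : m * (r + 1) ≤ n + r) (I : Finset (Fin m)) (hI : 2 ≤ I.card) :
    k + I.card ≤ (I.biUnion B).card := by
  classical
  rcases hI.eq_or_lt with h2 | h3
  · obtain ⟨i, i', hne, rfl⟩ := Finset.card_eq_two.mp h2.symm
    have h := Finset.card_union_add_card_inter (B i) (B i')
    have := hinter i i' hne
    rw [hcard, hcard] at h
    rw [← h2, Finset.biUnion_insert, Finset.singleton_biUnion]
    omega
  -- For `|I| ≥ 3` the other blocks cover at most `(m - |I|)(r + 1)` points, leaving at least `|I|(r
  -- + 1) - r ≥ 2r + |I| ≥ k + |I|`.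
  · have huniv : (Finset.univ : Finset (Fin n)) ⊆ I.biUnion B ∪ Iᶜ.biUnion B := fun j _ => by
      obtain ⟨i, hi⟩ := hcover j
      by_cases hiI : i ∈ I
      · exact Finset.mem_union_left _ (Finset.mem_biUnion.mpr ⟨i, hiI, hi⟩)
      · exact Finset.mem_union_right _
          (Finset.mem_biUnion.mpr ⟨i, Finset.mem_compl.mpr hiI, hi⟩)
    have h1 := (Finset.card_le_card huniv).trans (Finset.card_union_le _ _)
    have h2 := Finset.card_biUnion_le_card_mul Iᶜ B (r + 1) fun i _ => (hcard i).le
    have h4 := Finset.card_add_card_compl I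
    rw [Finset.card_univ, Fintype.card_fin] at h1
    rw [Fintype.card_fin] at h4
    have h5 : m * (r + 1) = I.card * (r + 1) + Iᶜ.card * (r + 1) := by rw [← add_mul, h4]
    have h6 : 3 * r ≤ I.card * r := Nat.mul_le_mul_right r h3
    have h7 : I.card * (r + 1) = I.card * r + I.card := by ring
    omega

/-! ### Necessity and sufficiency of the inequality -/

theorem n₂_le_of_isLRC {F : Type*} [Field F] [DecidableEq F] {n k r : ℕ}
    {C : Submodule F (Fin n → F)} (hrk : r < k) (hkn : k < n) (hk₁ : k₁ k r = 2) (hr : 1 ≤ r)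
    (hC : IsLRC C k r) (hd : n - k ≤ minDist C) :
    n₂ n r ≤ (n₁ n r).choose 2 * k₂ k r := by
  classical
  obtain ⟨hCk, hloc⟩ := hC
  choose A hAmem hAcard hA using fun i => hloc.exists_isDualSupport i
  have hn₁ : n₁ n r ≤ (Finset.univ.image A).card := by
    refine n₁_le ?_
    have h1 : (Finset.univ : Finset (Fin n)) ⊆ (Finset.univ.image A).biUnion id := fun j _ =>
      Finset.mem_biUnion.mpr ⟨A j, Finset.mem_image_of_mem _ (Finset.mem_univ _), hAmem j⟩
    have h2 := (Finset.card_le_card h1).trans (Finset.card_biUnion_le_card_mul _ _ (r + 1) (by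
      intro B hB
      obtain ⟨i, -, rfl⟩ := Finset.mem_image.mp hB
      exact hAcard i))
    simpa using h2
  obtain ⟨𝒜, h𝒜, h𝒜c⟩ := Finset.exists_subset_card_eq hn₁
  have hk₂ := k₂_add k r hr
  have hn₂ := n₂_add n r
  rw [hk₁] at hk₂
  -- A single block would give `n ≤ r + 1 ≤ k`.
  have h2 : 2 ≤ n₁ n r := by
    by_contra! hlt
    have : n₁ n r * (r + 1) ≤ 1 * (r + 1) := Nat.mul_le_mul_right _ (by omega)
    omega
  have h := le_card_biUnion_add (b := k₂ k r) (s := r + 1) (l := k + 2) (by omega) 𝒜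
    (fun B hB => by
      obtain ⟨i, -, rfl⟩ := Finset.mem_image.mp (h𝒜 hB)
      exact hAcard i)
    (fun B hB D hD hBD => by
      obtain ⟨i, -, rfl⟩ := Finset.mem_image.mp (h𝒜 hB)
      obtain ⟨j, -, rfl⟩ := Finset.mem_image.mp (h𝒜 hD)
      have := (hA i).card_union (hA j) hBD ⟨i, hAmem i⟩ ⟨j, hAmem j⟩ (by omega) (by omega)
      rwa [hCk] at this)
    (by omega)
  rw [h𝒜c] at h
  have := card_finset_fin_le (𝒜.biUnion id)
  omega

theorem exists_isLRC_of_n₂_le {n k r : ℕ} (hrk : r < k) (hr : 1 ≤ r) (hk₁ : k₁ k r = 2)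
    (hkn : k < n) (h : n₂ n r ≤ (n₁ n r).choose 2 * k₂ k r) :
    ∃ (p : ℕ) (_ : Fact p.Prime) (C : Submodule (ZMod p) (Fin n → ZMod p)),
      IsLRC C k r ∧ n - k ≤ minDist C := by
  have hk₂ := k₂_add k r hr
  have hn₂ := n₂_add n r
  have hn₂r := n₂_le n r
  rw [hk₁] at hk₂
  obtain ⟨B, hcard, hcover, hinter⟩ := exists_blocks hn₂ h (by omega)
  have hB := add_card_le_card_biUnion hcard hcover hinter hk₂ (by omega)
  refine exists_isLRC (by omega) B (fun i => (hcard i).le) hcover ?_ hB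
  have h2 : 2 ≤ n₁ n r := by
    by_contra! hlt
    have : n₁ n r * (r + 1) ≤ 1 * (r + 1) := Nat.mul_le_mul_right _ (by omega)
    omega
  have h3 := hB Finset.univ (by simpa using h2)
  have h4 := card_finset_fin_le (Finset.univ.biUnion B)
  rw [Finset.card_univ, Fintype.card_fin] at h3
  omega

theorem largestMinDistEq_iff {n k r : ℕ} (hr : 1 ≤ r) (hkn : k < n) (hk₁ : k₁ k r = 2) :
    LargestMinDistEq n k r (dStar n k r) ↔ n₂ n r ≤ (n₁ n r).choose 2 * k₂ k r := by
  classical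
  have hrk : r < k := lt_of_one_lt_k₁ hr (by omega)
  rw [dStar_eq_of_k₁_eq_two hk₁ hkn.le]
  constructor
  · rintro ⟨⟨F, _, _, C, hC, hd⟩, -⟩
    exact n₂_le_of_isLRC hrk hkn hk₁ hr hC (Nat.cast_inj.mp hd).ge
  · intro h
    refine ⟨?_, ?_⟩
    · obtain ⟨p, hp, C, hC, hd⟩ := exists_isLRC_of_n₂_le hrk hr hk₁ hkn h
      refine ⟨ZMod p, inferInstance, inferInstance, C, hC, ?_⟩
      have h1 := minDist_le hrk hkn.le hC
      have h2 := h1.antisymm hd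
      rw [← h2]
      -- The two sides differ only in the decidable-equality instance.
      congr!
    · rintro _ ⟨F, _, _, C, hC, rfl⟩
      exact_mod_cast minDist_le hrk hkn.le hC

end LRC

theorem mainTheorem8 (n k r : ℕ) (hr : 1 ≤ r) (hrk : r ≤ k) (hkn : k < n)
    (hk₁ : LRC.k₁ k r = 2) :
    -- the largest minimum distance is `d*` if and only if `n₂ ≤ C(n₁, 2) k₂`
    (LRC.LargestMinDistEq n k r (LRC.dStar n k r) ↔
      LRC.n₂ n r ≤ (LRC.n₁ n r).choose 2 * LRC.k₂ k r) ∧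
    -- the multigraph with `k₂` parallel edges between every pair of its `n₁` vertices has no
    -- subgraph of order `k₁` and size greater than `k₂`, it has size `C(n₁, 2) k₂`, and ...
    LRC.HasNoDenseSubgraph (LRC.parallelComplete (LRC.n₁ n r) (LRC.k₂ k r))
      (LRC.k₁ k r) (LRC.k₂ k r) ∧
    E(LRC.parallelComplete (LRC.n₁ n r) (LRC.k₂ k r)).encard =
      (((LRC.n₁ n r).choose 2 * LRC.k₂ k r : ℕ) : ℕ∞) ∧
    -- ... it has the maximum size among all loopless multigraphs of order `n₁` with this property
    ∀ (α β : Type*) (G : Graph α β), G.Loopless → V(G).encard = LRC.n₁ n r →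
      LRC.HasNoDenseSubgraph G (LRC.k₁ k r) (LRC.k₂ k r) →
      E(G).encard ≤ E(LRC.parallelComplete (LRC.n₁ n r) (LRC.k₂ k r)).encard := by
  rw [hk₁, LRC.parallelComplete_size]
  exact ⟨LRC.largestMinDistEq_iff hr hkn hk₁, LRC.parallelComplete_hasNoDenseSubgraph _ _, rfl,
    fun α β G hG hV h => LRC.encard_edgeSet_le hG hV h⟩
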